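/- Let $G$ be a locally compact (Hausdorff) group with a left Haar measure $m_G$. Let $L^\infty(G)$ be the space of bounded Borel functions $G\to\mathbf{R}$ modulo equality locally $m_G$-almost everywhere (two functions are identified if the set where they differ meets every compact set in an $m_G$-null set; for $\sigma$-compact $G$ this is equality $m_G$-almost everywhere), ordered by $\le$ locally almost everywhere. Let $\mathcal{C}^b(G)$ be the space of bounded continuous functions $G\to\mathbf{R}$ with the pointwise order, and define the subspaces $$\mathcal{C}^b_{ru}(G)=\Big\{f\in\mathcal{C}^b(G):\lim_{u\to e}\sup_{x\in G}|f(ux)-f(x)|=0\Big\},\qquad \mathcal{C}^b_{lu}(G)=\Big\{f\in\mathcal{C}^b(G):\lim_{u\to e}\sup_{x\in G}|f(xu)-f(x)|=0\Big\},$$ $$\mathcal{C}^b_{u}(G)=\mathcal{C}^b_{lu}(G)\cap\mathcal{C}^b_{ru}(G).$$ Let $G$ act on each of these spaces by left translation, $(gf)(x)=f(g^{-1}x)$. For $E$ one of these five spaces and a non-zero $f\in E$ with $f\ge 0$, the $f$-dominated ideal is $$(E,f)=\Big\{h\in E:\ |h|\le \sum_{j=1}^n t_j\,g_jf\ \text{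 for some } n\in\mathbf{N},\ g_1,\dots,g_n\in G,\ t_1,\dots,t_n\ge 0\Big\}.$$ One says that $G$ has the invariant normalized integral property for $E$ if for every non-zero $f\in E$ with $f\ge 0$ there is a linear functional $\mathrm{I}:(E,f)\to\mathbf{R}$ which is positive ($\mathrm{I}(h)\ge 0$ whenever $h\ge 0$), $G$-invariant ($\mathrm{I}(gh)=\mathrm{I}(h)$ for all $g\in G$ and $h\in(E,f)$) and normalized ($\mathrm{I}(f)=1$). Then the following are equivalent: $G$ has the invariant normalized integral property for $L^\infty(G)$; for $\mathcal{C}^b(G)$; for $\mathcal{C}^b_{lu}(G)$; for $\mathcal{C}^b_{ru}(G)$; for $\mathcal{C}^b_u(G)$. That is, $G$ has the property for one of these five spaces if and only if it has it for all of them. -/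

import Mathlib

open MeasureTheory Topology Filter
open scoped BoundedContinuousFunction

/-! ### Dominated ideals and invariant normalized integrals

`X` is a real vector lattice on which `G` acts linearly through `ρ`, and `E` is a linear subspace
of `X`, ordered by the order of `X`. -/

section Abstract

variable {G X : Type*} [Group G] [AddCommGroup X] [Lattice X] [IsOrderedAddMonoid X]
  [Module ℝ X] [PosSMulMono ℝ X]

/-- The `f`-dominated ideal `(E, f)`: all `h ∈ E` for which there are finitely many `g₁, …, gₙ ∈ G`
and reals `t₁, …, tₙ ≥ 0` with `|h| ≤ t₁ g₁ f + ⋯ + tₙ gₙ f`. The finitely supported function `t`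
records the coefficients. -/
def dominatedIdeal (ρ : Representation ℝ G X) (E : Submodule ℝ X) (f : X) : Submodule ℝ X where
  carrier := {h | h ∈ E ∧ ∃ t : G →₀ ℝ, (∀ g, 0 ≤ t g) ∧ |h| ≤ t.sum fun g c => c • ρ g f}
  zero_mem' := ⟨E.zero_mem, 0, by simp, by simp⟩
  add_mem' := by
    rintro a b ⟨ha, s, hs, hsa⟩ ⟨hb, t, ht, htb⟩
    refine ⟨E.add_mem ha hb, s + t, fun g => add_nonneg (hs g) (ht g), ?_⟩
    rw [Finsupp.sum_add_index' (by simp) (by intros; rw [add_smul])]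
    exact (abs_add_le a b).trans (add_le_add hsa htb)
  smul_mem' := by
    rintro c a ⟨ha, s, hs, hsa⟩
    refine ⟨E.smul_mem c ha, |c| • s, fun g => mul_nonneg (abs_nonneg c) (hs g), ?_⟩
    rw [Finsupp.sum_smul_index (by simp)]
    simp only [mul_smul]
    rw [← Finsupp.smul_sum]
    refine le_trans ?_ (smul_le_smul_of_nonneg_left hsa (abs_nonneg c))
    have key : ∀ (d : ℝ), 0 ≤ d → ∀ x : X, |d • x| ≤ d • |x| := fun d hd x =>
      abs_le'.2 ⟨smul_le_smul_of_nonneg_left (le_abs_self x) hd, by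
        rw [← smul_neg]; exact smul_le_smul_of_nonneg_left (neg_le_abs x) hd⟩
    rcases abs_cases c with ⟨h, h0⟩ | ⟨h, h0⟩
    · rw [h]; exact key c h0 a
    · rw [h, ← abs_neg, ← neg_smul]; exact key (-c) (by linarith) a

theorem self_mem_dominatedIdeal (ρ : Representation ℝ G X) {E : Submodule ℝ X} {f : X}
    (hf : f ∈ E) (h0 : 0 ≤ f) : f ∈ dominatedIdeal ρ E f := by
  refine ⟨hf, Finsupp.single 1 1, fun g => ?_, ?_⟩
  · classical
    rw [Finsupp.single_apply]; split_ifs <;> norm_num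
  · rw [Finsupp.sum_single_index (by simp), abs_of_nonneg h0]; simp

/-- `G` has the invariant normalized integral property for `E`: for every non-zero `f ∈ E` with
`f ≥ 0` there is a positive `G`-invariant linear functional `I` on `(E, f)` with `I f = 1`. Invariance is `I (g h) = I h`, with `h'` standing for the
translate `g h`, which lies in `(E, f)` when `E` is `G`-invariant and `ρ` is order preserving. -/
def InvariantNormalizedIntegralProperty (ρ : Representation ℝ G X) (E : Submodule ℝ X) : Prop :=
  ∀ (f : X) (hf : f ∈ E) (h0 : 0 ≤ f), f ≠ 0 →
    ∃ I : dominatedIdeal ρ E f →ₗ[ℝ] ℝ,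
      (∀ h : dominatedIdeal ρ E f, 0 ≤ (h : X) → 0 ≤ I h) ∧
      (∀ (g : G) (h h' : dominatedIdeal ρ E f), (h' : X) = ρ g h → I h' = I h) ∧
      I ⟨f, self_mem_dominatedIdeal ρ hf h0⟩ = 1

end Abstract

/-! ### The spaces of bounded continuous functions -/

section Continuous

variable (G : Type*) [Group G] [TopologicalSpace G] [IsTopologicalGroup G]

instance bcfPosSMulMono : PosSMulMono ℝ (G →ᵇ ℝ) where
  smul_le_smul_of_nonneg_left _ hc _ _ h := fun x => mul_le_mul_of_nonneg_left (h x) hc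

/-- The left-translation representation on bounded continuous functions, `(g f)(x) = f (g⁻¹ x)`. -/
def translationBCF : Representation ℝ G (G →ᵇ ℝ) where
  toFun g :=
    { toFun := fun f => f.compContinuous ⟨fun x => g⁻¹ * x, continuous_const_mul g⁻¹⟩
      map_add' := fun _ _ => rfl
      map_smul' := fun _ _ => rfl }
  map_one' := by ext f x; simp
  map_mul' g k := by
    ext f x
    change f ((g * k)⁻¹ * x) = f (k⁻¹ * (g⁻¹ * x))
    rw [mul_inv_rev, mul_assoc]

/-- `C^b(G)`. -/
def Cb : Submodule ℝ (G →ᵇ ℝ) := ⊤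

/-- `C^b_ru(G)`: `|f (u x) - f x|` is small uniformly in `x` when `u` is close to `1`, that is, `f`
is uniformly continuous for the right uniformity. Equivalently, the orbit map `g ↦ g f` of the
left-translation representation is norm continuous. -/
def Cru : Submodule ℝ (G →ᵇ ℝ) where
  carrier := {f | ∀ ε : ℝ, 0 < ε → ∀ᶠ u in 𝓝 (1 : G), ∀ x, |f (u * x) - f x| < ε}
  zero_mem' := fun ε hε => Eventually.of_forall fun u x => by simpa using hε
  add_mem' := by
    intro a b ha hb ε hε
    filter_upwards [ha (ε / 2) (half_pos hε), hb (ε / 2) (half_pos hε)] with u h₁ h₂ x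
    have h₃ := abs_add_le (a (u * x) - a x) (b (u * x) - b x)
    have h₄ : (a + b) (u * x) - (a + b) x = a (u * x) - a x + (b (u * x) - b x) := by
      simp only [BoundedContinuousFunction.coe_add, Pi.add_apply]; ring
    rw [h₄]; linarith [h₁ x, h₂ x]
  smul_mem' := by
    intro c a ha ε hε
    have hc : 0 < |c| + 1 := by positivity
    filter_upwards [ha (ε / (|c| + 1)) (div_pos hε hc)] with u h₁ x
    have h₂ : (c • a) (u * x) - (c • a) x = c * (a (u * x) - a x) := by
      simp only [BoundedContinuousFunction.coe_smul, smul_eq_mul]; ring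
    rw [h₂, abs_mul]
    have h₃ := (lt_div_iff₀ hc).1 (h₁ x)
    nlinarith [abs_nonneg (a (u * x) - a x)]

/-- `C^b_lu(G)`: `|f (x u) - f x|` is small uniformly in `x` when `u` is close to `1`, that is, `f`
is uniformly continuous for the left uniformity. -/
def Clu : Submodule ℝ (G →ᵇ ℝ) where
  carrier := {f | ∀ ε : ℝ, 0 < ε → ∀ᶠ u in 𝓝 (1 : G), ∀ x, |f (x * u) - f x| < ε}
  zero_mem' := fun ε hε => Eventually.of_forall fun u x => by simpa using hε
  add_mem' := by
    intro a b ha hb ε hε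
    filter_upwards [ha (ε / 2) (half_pos hε), hb (ε / 2) (half_pos hε)] with u h₁ h₂ x
    have h₃ := abs_add_le (a (x * u) - a x) (b (x * u) - b x)
    have h₄ : (a + b) (x * u) - (a + b) x = a (x * u) - a x + (b (x * u) - b x) := by
      simp only [BoundedContinuousFunction.coe_add, Pi.add_apply]; ring
    rw [h₄]; linarith [h₁ x, h₂ x]
  smul_mem' := by
    intro c a ha ε hε
    have hc : 0 < |c| + 1 := by positivity
    filter_upwards [ha (ε / (|c| + 1)) (div_pos hε hc)] with u h₁ x
    have h₂ : (c • a) (x * u) - (c • a) x = c * (a (x * u) - a x) := by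
      simp only [BoundedContinuousFunction.coe_smul, smul_eq_mul]; ring
    rw [h₂, abs_mul]
    have h₃ := (lt_div_iff₀ hc).1 (h₁ x)
    nlinarith [abs_nonneg (a (x * u) - a x)]

/-- `C^b_u(G)`: both left and right uniformly continuous. -/
def Cu : Submodule ℝ (G →ᵇ ℝ) := Clu G ⊓ Cru G

end Continuous

/-! ### The space `L^∞(G)` -/

section Linfty

variable {G : Type*} [Group G] [TopologicalSpace G] [IsTopologicalGroup G]
  [MeasurableSpace G] [BorelSpace G]

/-- The filter of sets with locally null complement: `N` is locally null if `N ∩ K` is null for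
every compact `K`. On a σ-compact group this is the filter of sets with null complement. -/
def locallyAE (μ : Measure G) : Filter G where
  sets := {s | ∀ K : Set G, IsCompact K → μ (sᶜ ∩ K) = 0}
  univ_sets := fun K _ => by simp
  sets_of_superset := fun {s t} hs hst K hK =>
    measure_mono_null (Set.inter_subset_inter_left K (Set.compl_subset_compl.2 hst)) (hs K hK)
  inter_sets := fun {s t} hs ht K hK => by
    rw [Set.compl_inter, Set.union_inter_distrib_right]
    exact measure_union_null (hs K hK) (ht K hK)

theorem tendsto_mul_left_locallyAE (μ : Measure G) [μ.IsMulLeftInvariant] (g : G) :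
    Tendsto (fun x => g * x) (locallyAE μ) (locallyAE μ) := by
  intro s hs K hK
  have h := hs ((fun x => g * x) '' K) (hK.image (continuous_const_mul g))
  rw [← measure_preimage_mul μ g] at h
  rw [Set.preimage_inter, Set.preimage_image_eq K (mul_right_injective g)] at h
  exact h

instance germPosSMulMono {α : Type*} (l : Filter α) : PosSMulMono ℝ (Germ l ℝ) where
  smul_le_smul_of_nonneg_left c hc a b := by
    induction a using Germ.inductionOn with | _ a
    induction b using Germ.inductionOn with | _ b
    intro h
    have h' : a ≤ᶠ[l] b := Germ.coe_le.1 h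
    exact Germ.coe_le.2 (h'.mono fun x hx => mul_le_mul_of_nonneg_left hx hc)

/-- The left-translation representation on classes of real functions on `G` modulo equality
locally almost everywhere, `(g f)(x) = f (g⁻¹ x)`. These classes form a vector lattice, ordered by
`≤` locally almost everywhere. -/
def translationGerm (μ : Measure G) [μ.IsMulLeftInvariant] :
    Representation ℝ G (Germ (locallyAE μ) ℝ) where
  toFun g :=
    { toFun := fun F => F.compTendsto (fun x => g⁻¹ * x) (tendsto_mul_left_locallyAE μ g⁻¹)
      map_add' := fun F H => by
        induction F using Germ.inductionOn with | _ f
        induction H using Germ.inductionOn with | _ h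
        rfl
      map_smul' := fun c F => by
        induction F using Germ.inductionOn with | _ f
        rfl }
  map_one' := by
    ext F
    induction F using Germ.inductionOn with | _ f
    exact Germ.coe_eq.2 (Eventually.of_forall fun x => by simp)
  map_mul' g k := by
    ext F
    induction F using Germ.inductionOn with | _ f
    exact Germ.coe_eq.2 (Eventually.of_forall fun x => by simp [mul_assoc])

/-- `L^∞(G)`: bounded Borel functions modulo equality locally almost everywhere. -/
def Linfty (μ : Measure G) : Submodule ℝ (Germ (locallyAE μ) ℝ) where
  carrier := {F | ∃ f : G → ℝ, Measurable f ∧ (∃ C : ℝ, ∀ x, |f x| ≤ C) ∧ F = (f : Germ _ ℝ)}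
  zero_mem' := ⟨0, measurable_zero, ⟨0, by simp⟩, rfl⟩
  add_mem' := by
    rintro _ _ ⟨f, hf, ⟨C, hC⟩, rfl⟩ ⟨h, hh, ⟨D, hD⟩, rfl⟩
    exact ⟨f + h, hf.add hh,
      ⟨C + D, fun x => (abs_add_le _ _).trans (add_le_add (hC x) (hD x))⟩, rfl⟩
  smul_mem' := by
    rintro c _ ⟨f, hf, ⟨C, hC⟩, rfl⟩
    refine ⟨c • f, hf.const_smul c, ⟨|c| * C, fun x => ?_⟩, rfl⟩
    rw [Pi.smul_apply, smul_eq_mul, abs_mul]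
    exact mul_le_mul_of_nonneg_left (hC x) (abs_nonneg c)

end Linfty

open scoped CompactlySupported

set_option linter.unusedSectionVars false

/-! ### Transfer of invariant integrals between dominated ideals -/

section Transfer

variable {G X Y : Type*} [Group G] [AddCommGroup X] [Lattice X] [IsOrderedAddMonoid X]
  [Module ℝ X] [PosSMulMono ℝ X] [AddCommGroup Y] [Lattice Y] [IsOrderedAddMonoid Y]
  [Module ℝ Y] [PosSMulMono ℝ Y]

/-! An integral pulls back along any positive equivariant linear map that kills no non-zero
nonnegative element (`InvariantNormalizedIntegralProperty.of_equivariant`). Inclusions between the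
function spaces and the map from continuous functions to `L^∞` classes are of this kind. It remains
to climb back from the smallest space to the largest by smoothing.

Left uniform continuity is gained by right convolution, which commutes with left translation, so the
same principle carries the property from `Cu` to `Cru`.

Right uniform continuity has to be gained by convolving with some `φ` on the left, which does not
commute with left translation: translating `F` by `g` replaces `φ` by a right translate, times the
modular function at `g`. The remedy is uniqueness of Haar measure. If `I` is an invariant integral
on the ideal of `φ * F` and `H ≥ 0` lies in the ideal of `F`, then `ψ ↦ I (ψ * H)` is a positive
left-invariant functional on `C_c(G, ℝ)`, hence a multiple of the Haar integral. It therefore sees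
only the mass of `ψ`, and the modular factor exactly restores the mass lost or gained by right
translation. So `H ↦ I (φ * H)` is invariant (`Linfty_of_Cru`). It is defined on the whole ideal
because finitely many left translates of `φ` dominate any `ψ`. -/

theorem mem_dominatedIdeal_of_abs_le {ρ : Representation ℝ G X} {E : Submodule ℝ X} {f y z : X}
    (hy : y ∈ E) (hz : z ∈ dominatedIdeal ρ E f) (h : |y| ≤ z) : y ∈ dominatedIdeal ρ E f := by
  obtain ⟨-, t, ht, hzt⟩ := hz
  exact ⟨hy, t, ht, h.trans ((le_abs_self z).trans hzt)⟩

theorem translate_mem_dominatedIdeal {ρ : Representation ℝ G X} {E : Submodule ℝ X} {f : X} {g : G}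
    (hf : ρ g f ∈ E) (h0 : 0 ≤ ρ g f) : ρ g f ∈ dominatedIdeal ρ E f := by
  refine ⟨hf, Finsupp.single g 1, fun k => ?_, ?_⟩
  · exact (Finsupp.single_nonneg.2 zero_le_one : (0 : G →₀ ℝ) ≤ _) k
  · rw [Finsupp.sum_single_index (by simp), abs_of_nonneg h0, one_smul]

/-- A member of a dominated ideal is bounded in absolute value by a nonnegative member. -/
theorem exists_abs_le_mem_dominatedIdeal {ρ : Representation ℝ G X} {E : Submodule ℝ X} {f h : X}
    (hE : ∀ g, ρ g f ∈ E) (h0 : ∀ g, 0 ≤ ρ g f) (hh : h ∈ dominatedIdeal ρ E f) :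
    ∃ z ∈ dominatedIdeal ρ E f, |h| ≤ z := by
  obtain ⟨-, t, -, hht⟩ := hh
  exact ⟨_, Submodule.sum_mem _ fun g _ => Submodule.smul_mem _ _
    (translate_mem_dominatedIdeal (hE g) (h0 g)), hht⟩

/-- Positivity carries the bound `|h| ≤ S` by a combination of translates to `|T h| ≤ T S`.
Equivariance of `T` is not required, only that images of translates of `f` are dominated; left
convolution is used in this form. -/
theorem map_mem_dominatedIdeal {ρ : Representation ℝ G X} {σ : Representation ℝ G Y}
    {E : Submodule ℝ X} {F : Submodule ℝ Y} {f : X} {f' : Y} {T : E →ₗ[ℝ] Y}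
    (hpos : ∀ h : E, 0 ≤ (h : X) → 0 ≤ T h) (hE : ∀ g, ρ g f ∈ E)
    (hT : ∀ g, T ⟨ρ g f, hE g⟩ ∈ dominatedIdeal σ F f') {h : E}
    (hh : (h : X) ∈ dominatedIdeal ρ E f) (hF : T h ∈ F) : T h ∈ dominatedIdeal σ F f' := by
  obtain ⟨-, t, ht, hht⟩ := hh
  set S : E := t.sum fun g c => c • (⟨ρ g f, hE g⟩ : E) with hS
  have hSX : (S : X) = t.sum fun g c => c • ρ g f := by
    rw [hS, Finsupp.sum, Finsupp.sum, AddSubmonoidClass.coe_finsetSum]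
    rfl
  rw [← hSX] at hht
  have hTS : T S ∈ dominatedIdeal σ F f' := by
    rw [hS, Finsupp.sum, map_sum]
    refine Submodule.sum_mem _ fun g _ => ?_
    rw [map_smul]
    exact Submodule.smul_mem _ _ (hT g)
  refine mem_dominatedIdeal_of_abs_le hF hTS (abs_le'.2 ⟨?_, ?_⟩)
  · have := hpos (S - h) (sub_nonneg.2 ((le_abs_self _).trans hht))
    rwa [map_sub, sub_nonneg] at this
  · have := hpos (S + h) (by
      rw [Submodule.coe_add, ← sub_neg_eq_add]
      exact sub_nonneg.2 ((neg_le_abs _).trans hht))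
    rwa [map_add, ← sub_neg_eq_add, sub_nonneg] at this

theorem map_translate_mem_dominatedIdeal {ρ : Representation ℝ G X} {E : Submodule ℝ X} {f : X}
    (hρ : ∀ g x, 0 ≤ x → 0 ≤ ρ g x) (hE : ∀ g, ∀ x ∈ E, ρ g x ∈ E) (h0 : 0 ≤ f) (hf : f ∈ E)
    (g : G) {h : X} (hh : h ∈ dominatedIdeal ρ E f) : ρ g h ∈ dominatedIdeal ρ E f := by
  refine map_mem_dominatedIdeal (T := ρ g ∘ₗ E.subtype) (h := ⟨h, hh.1⟩) (fun x hx => hρ g x hx)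
    (fun k => hE k f hf) (fun k => ?_) hh (hE g h hh.1)
  have hk : ρ g (ρ k f) = ρ (g * k) f := by rw [map_mul]; rfl
  change ρ g (ρ k f) ∈ _
  rw [hk]
  exact translate_mem_dominatedIdeal (hE _ f hf) (hρ _ f h0)

/-- The restriction of a linear map to dominated ideals. -/
def dominatedIdealMap (ρ : Representation ℝ G X) (σ : Representation ℝ G Y)
    {E : Submodule ℝ X} (F : Submodule ℝ Y) (f : X) (f' : Y) (T : E →ₗ[ℝ] Y)
    (hT : ∀ h : E, (h : X) ∈ dominatedIdeal ρ E f → T h ∈ dominatedIdeal σ F f') :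
    dominatedIdeal ρ E f →ₗ[ℝ] dominatedIdeal σ F f' where
  toFun h := ⟨T ⟨h, h.2.1⟩, hT ⟨h, h.2.1⟩ h.2⟩
  map_add' a b := Subtype.ext (T.map_add ⟨a, a.2.1⟩ ⟨b, b.2.1⟩)
  map_smul' c a := Subtype.ext (T.map_smul c ⟨a, a.2.1⟩)

/-- The property passes from `F` to `E` along a positive equivariant linear map `E → F` which does
not kill any non-zero nonnegative element. -/
theorem InvariantNormalizedIntegralProperty.of_equivariant {ρ : Representation ℝ G X}
    {σ : Representation ℝ G Y} {E : Submodule ℝ X} {F : Submodule ℝ Y}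
    (hσ : InvariantNormalizedIntegralProperty σ F) (hρ : ∀ g x, 0 ≤ x → 0 ≤ ρ g x)
    (hE : ∀ g, ∀ x ∈ E, ρ g x ∈ E) (T : E →ₗ[ℝ] Y) (hTF : ∀ h, T h ∈ F)
    (hpos : ∀ h : E, 0 ≤ (h : X) → 0 ≤ T h) (hne : ∀ h : E, 0 ≤ (h : X) → T h = 0 → h = 0)
    (hT : ∀ g (h : E), T ⟨ρ g h, hE g h h.2⟩ = σ g (T h)) :
    InvariantNormalizedIntegralProperty ρ E := by
  intro f hf h0 hf0
  have hTf0 : 0 ≤ T ⟨f, hf⟩ := hpos _ h0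
  obtain ⟨I, Ipos, Iinv, Inorm⟩ := hσ (T ⟨f, hf⟩) (hTF _) hTf0
    fun h => hf0 (congrArg Subtype.val (hne ⟨f, hf⟩ h0 h))
  have key : ∀ h : E, (h : X) ∈ dominatedIdeal ρ E f →
      T h ∈ dominatedIdeal σ F (T ⟨f, hf⟩) := fun h hh =>
    map_mem_dominatedIdeal hpos (fun g => hE g f hf) (fun g => by
      have h1 := hT g ⟨f, hf⟩
      have h2 := hpos ⟨ρ g f, hE g f hf⟩ (hρ g f h0)
      have h3 := hTF ⟨ρ g f, hE g f hf⟩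
      rw [h1] at h2 h3 ⊢
      exact translate_mem_dominatedIdeal h3 h2) hh (hTF h)
  refine ⟨I ∘ₗ dominatedIdealMap ρ σ F f _ T key, fun h hh => Ipos _ (hpos _ hh),
    fun g h h' hh => Iinv g _ _ ?_, Inorm⟩
  have h1 := hT g ⟨h, h.2.1⟩
  have h2 : (⟨h', h'.2.1⟩ : E) = ⟨ρ g h, hE g h h.2.1⟩ := Subtype.ext hh
  rw [← h2] at h1
  exact h1

theorem InvariantNormalizedIntegralProperty.mono {ρ : Representation ℝ G X} {E F : Submodule ℝ X}
    (hF : InvariantNormalizedIntegralProperty ρ F) (hEF : E ≤ F)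
    (hρ : ∀ g x, 0 ≤ x → 0 ≤ ρ g x) (hE : ∀ g, ∀ x ∈ E, ρ g x ∈ E) :
    InvariantNormalizedIntegralProperty ρ E :=
  hF.of_equivariant hρ hE E.subtype (fun h => hEF h.2) (fun _ h => h)
    (fun _ _ h => Subtype.ext h) fun _ _ => rfl

end Transfer

/-! ### Invariance of the function spaces under left translation -/

section Translations

variable {G : Type*} [Group G] [TopologicalSpace G] [IsTopologicalGroup G]

theorem translationBCF_apply (g : G) (f : G →ᵇ ℝ) (x : G) :
    translationBCF G g f x = f (g⁻¹ * x) := rfl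

theorem translationBCF_nonneg (g : G) (f : G →ᵇ ℝ) (hf : 0 ≤ f) : 0 ≤ translationBCF G g f :=
  fun x => hf (g⁻¹ * x)

theorem translationBCF_mem_Clu (g : G) (f : G →ᵇ ℝ) (hf : f ∈ Clu G) :
    translationBCF G g f ∈ Clu G := by
  intro ε hε
  filter_upwards [hf ε hε] with u hu x
  simpa only [translationBCF_apply, mul_assoc] using hu (g⁻¹ * x)

theorem translationBCF_mem_Cru (g : G) (f : G →ᵇ ℝ) (hf : f ∈ Cru G) :
    translationBCF G g f ∈ Cru G := by
  intro ε hε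
  have h : Tendsto (fun u : G => g⁻¹ * u * g) (𝓝 1) (𝓝 1) := by
    have : Continuous fun u : G => g⁻¹ * u * g := by fun_prop
    simpa using this.tendsto 1
  filter_upwards [h.eventually (hf ε hε)] with u hu x
  simpa [translationBCF_apply, mul_assoc] using hu (g⁻¹ * x)

theorem translationBCF_mem_Cu (g : G) (f : G →ᵇ ℝ) (hf : f ∈ Cu G) :
    translationBCF G g f ∈ Cu G :=
  ⟨translationBCF_mem_Clu g f hf.1, translationBCF_mem_Cru g f hf.2⟩

end Translations

/-! ### Continuous functions inside `L^∞` -/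

section LocallyAE

variable {G : Type*} [Group G] [TopologicalSpace G] [IsTopologicalGroup G]
  [MeasurableSpace G] [BorelSpace G]

theorem ae_imp_of_eventually_locallyAE {μ : Measure G} {p : G → Prop}
    (h : ∀ᶠ x in locallyAE μ, p x) {K : Set G} (hK : IsCompact K) : ∀ᵐ x ∂μ, x ∈ K → p x := by
  have h1 : μ ({x | p x}ᶜ ∩ K) = 0 := h K hK
  rw [ae_iff]
  convert h1 using 2
  ext x
  simp [and_comm]

/-- Haar measure charges non-empty open sets, and by local compactness a point of difference has
such a set around it inside a compact set. -/
theorem eq_of_eventuallyEq_locallyAE [LocallyCompactSpace G] {μ : Measure G} [μ.IsHaarMeasure]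
    {a b : G → ℝ} (ha : Continuous a) (hb : Continuous b) (h : a =ᶠ[locallyAE μ] b) : a = b := by
  by_contra hne
  obtain ⟨x, hx⟩ := Function.ne_iff.1 hne
  obtain ⟨K, hK, hxK⟩ := exists_compact_mem_nhds x
  have hU : IsOpen ({x | a x ≠ b x} ∩ interior K) := (isOpen_ne_fun ha hb).inter isOpen_interior
  refine (hU.measure_pos μ ⟨x, hx, mem_interior_iff_mem_nhds.2 hxK⟩).ne' ?_
  exact measure_mono_null (Set.inter_subset_inter_right _ interior_subset) (h K hK)

theorem translationGerm_nonneg (μ : Measure G) [μ.IsMulLeftInvariant] (g : G)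
    (F : Germ (locallyAE μ) ℝ) (hF : 0 ≤ F) : 0 ≤ translationGerm μ g F := by
  induction F using Germ.inductionOn with | _ f
  exact (tendsto_mul_left_locallyAE μ g⁻¹).eventually (Germ.coe_le.1 hF)

theorem translationGerm_mem_Linfty (μ : Measure G) [μ.IsMulLeftInvariant] (g : G)
    (F : Germ (locallyAE μ) ℝ) (hF : F ∈ Linfty μ) : translationGerm μ g F ∈ Linfty μ := by
  obtain ⟨f, hf, ⟨C, hC⟩, rfl⟩ := hF
  exact ⟨_, hf.comp (measurable_const_mul g⁻¹), ⟨C, fun x => hC (g⁻¹ * x)⟩, rfl⟩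

/-- The class of a bounded continuous function modulo equality locally almost everywhere. -/
def germBCF (μ : Measure G) : (G →ᵇ ℝ) →ₗ[ℝ] Germ (locallyAE μ) ℝ where
  toFun f := ((f : G → ℝ) : Germ _ ℝ)
  map_add' _ _ := rfl
  map_smul' _ _ := rfl

theorem Cb_of_Linfty [LocallyCompactSpace G] (μ : Measure G) [μ.IsHaarMeasure]
    (h : InvariantNormalizedIntegralProperty (translationGerm μ) (Linfty μ)) :
    InvariantNormalizedIntegralProperty (translationBCF G) (Cb G) :=
  h.of_equivariant translationBCF_nonneg (fun _ _ _ => trivial) (germBCF μ ∘ₗ (Cb G).subtype)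
    (fun f => ⟨_, (f : G →ᵇ ℝ).continuous.measurable, ⟨‖(f : G →ᵇ ℝ)‖,
      (f : G →ᵇ ℝ).norm_coe_le_norm⟩, rfl⟩)
    (fun _ hf => Germ.coe_le.2 (Eventually.of_forall hf))
    (fun f _ hf => Subtype.ext (DFunLike.coe_injective (eq_of_eventuallyEq_locallyAE
      (f : G →ᵇ ℝ).continuous continuous_zero (Germ.coe_eq.1 hf))))
    fun _ _ => rfl

end LocallyAE

/-! ### Translates of compactly supported functions -/

section CompactSupport

variable {G : Type*} [Group G] [TopologicalSpace G] [IsTopologicalGroup G]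

/-- The left translate `x ↦ φ (g⁻¹ x)` of a compactly supported continuous function. -/
def leftTranslate (g : G) (φ : C_c(G, ℝ)) : C_c(G, ℝ) :=
  ⟨⟨fun x => φ (g⁻¹ * x), by fun_prop⟩,
    φ.hasCompactSupport.comp_homeomorph (Homeomorph.mulLeft g⁻¹)⟩

/-- The right translate `x ↦ φ (x g⁻¹)` of a compactly supported continuous function. -/
def rightTranslate (g : G) (φ : C_c(G, ℝ)) : C_c(G, ℝ) :=
  ⟨⟨fun x => φ (x * g⁻¹), by fun_prop⟩,
    φ.hasCompactSupport.comp_homeomorph (Homeomorph.mulRight g⁻¹)⟩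

theorem leftTranslate_apply (g : G) (φ : C_c(G, ℝ)) (x : G) :
    leftTranslate g φ x = φ (g⁻¹ * x) := rfl

theorem rightTranslate_apply (g : G) (φ : C_c(G, ℝ)) (x : G) :
    rightTranslate g φ x = φ (x * g⁻¹) := rfl

/-- A compactly supported continuous function is dominated by a nonnegative combination of left
translates of any given non-zero nonnegative function. -/
theorem exists_le_sum_leftTranslate {φ : C_c(G, ℝ)} (h0 : 0 ≤ φ) {a : G} (ha : φ a ≠ 0)
    (ψ : C_c(G, ℝ)) :
    ∃ t : G →₀ ℝ, (∀ g, 0 ≤ t g) ∧ ψ ≤ t.sum fun g c => c • leftTranslate g φ := by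
  have hnn : ∀ t : G →₀ ℝ, (∀ g, 0 ≤ t g) → ∀ x,
      0 ≤ (t.sum fun g c => c • leftTranslate g φ) x := fun t ht x => by
    rw [Finsupp.sum, CompactlySupportedContinuousMap.sum_apply]
    exact Finset.sum_nonneg fun g _ => mul_nonneg (ht g) (h0 _)
  -- It suffices to exceed `1` on the compact support of `ψ`; a bound `C` for `|ψ|` then rescales
  -- the coefficients.
  have hcover : ∃ t : G →₀ ℝ, (∀ g, 0 ≤ t g) ∧
      ∀ x ∈ tsupport ψ, 1 ≤ (t.sum fun g c => c • leftTranslate g φ) x := by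
    refine IsCompact.induction_on (p := fun s => ∃ t : G →₀ ℝ, (∀ g, 0 ≤ t g) ∧
      ∀ x ∈ s, 1 ≤ (t.sum fun g c => c • leftTranslate g φ) x) ψ.hasCompactSupport
      ⟨0, by simp, by simp⟩ ?_ ?_ ?_
    · rintro s s' hs ⟨t, ht, h⟩
      exact ⟨t, ht, fun x hx => h x (hs hx)⟩
    · rintro s s' ⟨t, ht, h⟩ ⟨t', ht', h'⟩
      refine ⟨t + t', fun g => add_nonneg (ht g) (ht' g), fun x hx => ?_⟩
      rw [Finsupp.sum_add_index' (by simp) (fun g c d => by ext; simp [add_mul]),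
        CompactlySupportedContinuousMap.add_apply]
      rcases hx with hx | hx
      · linarith [h x hx, hnn t' ht' x]
      · linarith [h' x hx, hnn t ht x]
    · intro x _
      have hpos : 0 < φ a := lt_of_le_of_ne (h0 a) ha.symm
      have hc : Continuous fun y => φ ((x * a⁻¹)⁻¹ * y) := by fun_prop
      have hev : ∀ᶠ y in 𝓝 x, φ a / 2 < φ ((x * a⁻¹)⁻¹ * y) := by
        refine hc.continuousAt.eventually_const_lt ?_
        simp [hpos]
      -- The translate by `x * a⁻¹` takes the value `φ a` at `x`, so it stays above `φ a / 2`
      -- nearby, and the coefficient `2 / φ a` lifts it above `1`.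
      refine ⟨_, mem_nhdsWithin_of_mem_nhds hev, Finsupp.single (x * a⁻¹) (2 / φ a),
        fun g => ?_, fun y hy => ?_⟩
      · exact (Finsupp.single_nonneg.2 (by positivity) : (0 : G →₀ ℝ) ≤ _) g
      · rw [Finsupp.sum_single_index (by simp), CompactlySupportedContinuousMap.smul_apply,
          leftTranslate_apply, smul_eq_mul, div_mul_eq_mul_div, le_div_iff₀ hpos]
        have : φ a / 2 < φ ((x * a⁻¹)⁻¹ * y) := hy
        linarith
  obtain ⟨t, ht, h⟩ := hcover
  obtain ⟨C, hC⟩ := ψ.hasCompactSupport.exists_bound_of_continuous ψ.continuous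
  have hC0 : 0 ≤ C := (norm_nonneg _).trans (hC 1)
  refine ⟨C • t, fun g => mul_nonneg hC0 (ht g), fun x => ?_⟩
  rw [Finsupp.sum_smul_index (by simp)]
  simp only [mul_smul]
  rw [← Finsupp.smul_sum]
  change ψ x ≤ C * (t.sum fun g c => c • leftTranslate g φ) x
  by_cases hx : x ∈ tsupport ψ
  · calc ψ x ≤ C * 1 := by rw [mul_one]; exact (le_abs_self _).trans (hC x)
      _ ≤ _ := mul_le_mul_of_nonneg_left (h x hx) hC0
  · rw [image_eq_zero_of_notMem_tsupport hx]
    exact mul_nonneg hC0 (hnn t ht x)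

variable [LocallyCompactSpace G] [MeasurableSpace G] [BorelSpace G]

/-- Weighted `L¹`-continuity of the action of a neighbourhood of `1` on compactly supported
continuous functions by a continuous family of homeomorphisms. -/
theorem tendsto_integral_abs_comp_sub (μ : Measure G) [IsFiniteMeasureOnCompacts μ] [T2Space G]
    {ψ w : G → ℝ} (hψ : Continuous ψ) (hψs : HasCompactSupport ψ) (hw : Continuous w)
    {a b : G → G → G} (ha : Continuous fun p : G × G => a p.1 p.2)
    (hb : Continuous fun p : G × G => b p.1 p.2) (hab : ∀ u x, b u (a u x) = x)
    (ha1 : ∀ x, a 1 x = x) :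
    Tendsto (fun u => ∫ x, |ψ (a u x) - ψ x| * w x ∂μ) (𝓝 1) (𝓝 0) := by
  obtain ⟨K, hK, hK1⟩ := exists_compact_mem_nhds (1 : G)
  -- For `u ∈ K` the integrand vanishes off this set: if `a u x` is in the support of `ψ`, then `x =
  -- b u (a u x)` is in the image.
  have hL : IsCompact ((fun p : G × G => b p.1 p.2) '' (K ×ˢ tsupport ψ) ∪ tsupport ψ) :=
    ((hK.prod hψs).image hb).union hψs
  have hcont : ContinuousOn (fun u => ∫ x, |ψ (a u x) - ψ x| * w x ∂μ) K := by
    refine continuousOn_integral_of_compact_support hL (Continuous.continuousOn ?_) ?_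
    · exact ((hψ.comp ha).sub (hψ.comp continuous_snd)).abs.mul (hw.comp continuous_snd)
    · intro u x hu hx
      have h1 : ψ x = 0 := image_eq_zero_of_notMem_tsupport fun h => hx (Or.inr h)
      have h2 : ψ (a u x) = 0 := image_eq_zero_of_notMem_tsupport fun h =>
        hx (Or.inl ⟨(u, a u x), ⟨hu, h⟩, hab u x⟩)
      simp [h1, h2]
  have := (hcont.continuousAt hK1).tendsto
  simpa [ha1] using this

end CompactSupport

/-! ### Right convolution: from `Cu` to `Cru` -/

section RightConvolution

variable {G : Type*} [Group G] [TopologicalSpace G] [IsTopologicalGroup G]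

theorem continuous_of_forall_eventually_mul_left {f : G → ℝ}
    (h : ∀ ε : ℝ, 0 < ε → ∀ᶠ u in 𝓝 (1 : G), ∀ x, |f (u * x) - f x| < ε) : Continuous f := by
  refine continuous_iff_continuousAt.2 fun x => Metric.tendsto_nhds.2 fun ε hε => ?_
  have hx : Tendsto (fun y : G => y * x⁻¹) (𝓝 x) (𝓝 1) := by
    have : Continuous fun y : G => y * x⁻¹ := by fun_prop
    simpa using this.tendsto x
  filter_upwards [hx.eventually (h ε hε)] with y hy
  simpa [Real.dist_eq] using hy x

theorem continuous_of_forall_eventually_mul_right {f : G → ℝ}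
    (h : ∀ ε : ℝ, 0 < ε → ∀ᶠ u in 𝓝 (1 : G), ∀ x, |f (x * u) - f x| < ε) : Continuous f := by
  refine continuous_iff_continuousAt.2 fun x => Metric.tendsto_nhds.2 fun ε hε => ?_
  have hx : Tendsto (fun y : G => x⁻¹ * y) (𝓝 x) (𝓝 1) := by
    have : Continuous fun y : G => x⁻¹ * y := by fun_prop
    simpa using this.tendsto x
  filter_upwards [hx.eventually (h ε hε)] with y hy
  simpa [Real.dist_eq] using hy x

variable [LocallyCompactSpace G] [T2Space G] [MeasurableSpace G] [BorelSpace G]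
  (μ : Measure G) [μ.IsHaarMeasure]

theorem integrable_comp_mul_mul (ψ : C_c(G, ℝ)) (f : G →ᵇ ℝ) (x : G) :
    Integrable (fun y => f (x * y) * ψ y) μ :=
  Continuous.integrable_of_hasCompactSupport (by fun_prop) ψ.hasCompactSupport.mul_left

/-- Left invariance of `μ` moves the perturbation `u` from `f` to `ψ`, so the bound does not depend
on `x` and needs only boundedness of `f`. -/
theorem rightConvolution_sub_le (ψ : C_c(G, ℝ)) (f : G →ᵇ ℝ) (u x : G) :
    |∫ y, f (x * u * y) * ψ y ∂μ - ∫ y, f (x * y) * ψ y ∂μ| ≤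
      ‖f‖ * ∫ y, |ψ (u⁻¹ * y) - ψ y| * 1 ∂μ := by
  have h1 : ∫ y, f (x * u * y) * ψ y ∂μ = ∫ y, f (x * y) * ψ (u⁻¹ * y) ∂μ := by
    rw [← integral_mul_left_eq_self (fun y => f (x * y) * ψ (u⁻¹ * y)) u]
    simp [mul_assoc]
  have hi : Integrable (fun y => ψ (u⁻¹ * y)) μ := (leftTranslate u ψ).integrable
  have h2 : Integrable (fun y => f (x * y) * ψ (u⁻¹ * y)) μ :=
    integrable_comp_mul_mul μ (leftTranslate u ψ) f x
  rw [h1, ← integral_sub h2 (integrable_comp_mul_mul μ ψ f x), ← integral_const_mul]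
  refine (abs_integral_le_integral_abs).trans (integral_mono_of_nonneg
    (Eventually.of_forall fun y => abs_nonneg _) ?_ (Eventually.of_forall fun y => ?_))
  · simpa using ((hi.sub ψ.integrable).abs.const_mul ‖f‖)
  · dsimp only
    rw [← mul_sub, abs_mul, mul_one]
    exact mul_le_mul_of_nonneg_right (f.norm_coe_le_norm _) (abs_nonneg _)

theorem rightConvolution_uniform (ψ : C_c(G, ℝ)) (f : G →ᵇ ℝ) (ε : ℝ) (hε : 0 < ε) :
    ∀ᶠ u in 𝓝 (1 : G), ∀ x,
      |∫ y, f (x * u * y) * ψ y ∂μ - ∫ y, f (x * y) * ψ y ∂μ| < ε := by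
  have h := (tendsto_integral_abs_comp_sub μ ψ.continuous ψ.hasCompactSupport
    (continuous_const (y := (1 : ℝ))) (a := fun u y => u⁻¹ * y) (b := fun u y => u * y)
    (by fun_prop) (by fun_prop) (by simp) (by simp)).const_mul ‖f‖
  rw [mul_zero] at h
  filter_upwards [h.eventually_lt_const hε] with u hu x
  exact (rightConvolution_sub_le μ ψ f u x).trans_lt hu

/-- Right convolution `f ↦ ∫ f (x y) ψ y dy`. -/
noncomputable def rightConvolution (ψ : C_c(G, ℝ)) : (G →ᵇ ℝ) →ₗ[ℝ] (G →ᵇ ℝ) where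
  toFun f := BoundedContinuousFunction.ofNormedAddCommGroup
    (fun x => ∫ y, f (x * y) * ψ y ∂μ)
    (continuous_of_forall_eventually_mul_right (rightConvolution_uniform μ ψ f))
    (‖f‖ * ∫ y, |ψ y| ∂μ) (fun x => by
      rw [← integral_const_mul]
      refine norm_integral_le_of_norm_le (ψ.integrable.abs.const_mul _)
        (Eventually.of_forall fun y => ?_)
      rw [norm_mul]
      exact mul_le_mul_of_nonneg_right (f.norm_coe_le_norm _) (norm_nonneg _))
  map_add' f g := by
    ext x
    change ∫ y, (f + g) (x * y) * ψ y ∂μ = _ + _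
    simp only [BoundedContinuousFunction.add_apply, add_mul]
    exact integral_add (integrable_comp_mul_mul μ ψ f x) (integrable_comp_mul_mul μ ψ g x)
  map_smul' c f := by
    ext x
    change ∫ y, (c • f) (x * y) * ψ y ∂μ = c * ∫ y, f (x * y) * ψ y ∂μ
    simp only [BoundedContinuousFunction.smul_apply, smul_eq_mul, mul_assoc]
    exact integral_const_mul _ _

theorem rightConvolution_apply (ψ : C_c(G, ℝ)) (f : G →ᵇ ℝ) (x : G) :
    rightConvolution μ ψ f x = ∫ y, f (x * y) * ψ y ∂μ := rfl

theorem rightConvolution_mem_Cru (ψ : C_c(G, ℝ)) {f : G →ᵇ ℝ} (hf : f ∈ Cru G) :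
    rightConvolution μ ψ f ∈ Cru G := by
  intro ε hε
  have hA : 0 ≤ ∫ y, |ψ y| ∂μ := integral_nonneg fun y => abs_nonneg _
  -- The `+ 1` keeps the denominator positive when `ψ = 0`.
  filter_upwards [hf (ε / (∫ y, |ψ y| ∂μ + 1)) (by positivity)] with u hu x
  rw [rightConvolution_apply, rightConvolution_apply,
    ← integral_sub (integrable_comp_mul_mul μ ψ f _) (integrable_comp_mul_mul μ ψ f x)]
  have h1 : ‖∫ y, (f (u * x * y) * ψ y - f (x * y) * ψ y) ∂μ‖ ≤
      ∫ y, ε / (∫ y, |ψ y| ∂μ + 1) * |ψ y| ∂μ := by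
    refine norm_integral_le_of_norm_le ((ψ.integrable (μ := μ)).abs.const_mul _)
      (Eventually.of_forall fun y => ?_)
    rw [← sub_mul, norm_mul, mul_assoc]
    exact mul_le_mul_of_nonneg_right (hu (x * y)).le (norm_nonneg _)
  refine h1.trans_lt ?_
  rw [integral_const_mul, div_mul_eq_mul_div, div_lt_iff₀ (by positivity)]
  nlinarith

/-- Right convolution by a bump `ψ` with `ψ 1 ≠ 0` adds left uniform continuity, keeps right uniform
continuity, and commutes with left translation. If `f ≥ 0` and `f x ≠ 0`, the convolution is
positive at `x`. -/
theorem Cru_of_Cu (h : InvariantNormalizedIntegralProperty (translationBCF G) (Cu G)) :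
    InvariantNormalizedIntegralProperty (translationBCF G) (Cru G) := by
  let μ : Measure G := Measure.haar
  obtain ⟨ψ, hψs, hψ0, hψ1⟩ := exists_continuous_nonneg_pos (1 : G)
  let ψ' : C_c(G, ℝ) := ⟨ψ, hψs⟩
  refine h.of_equivariant translationBCF_nonneg translationBCF_mem_Cru
    (rightConvolution μ ψ' ∘ₗ (Cru G).subtype)
    (fun f => ⟨rightConvolution_uniform μ ψ' f, rightConvolution_mem_Cru μ ψ' f.2⟩)
    (fun f hf x => integral_nonneg fun y => mul_nonneg (hf _) (hψ0 y)) (fun f hf hf0 => ?_) ?_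
  · by_contra hne
    have hne' : (f : G →ᵇ ℝ) ≠ 0 := fun h => hne (Subtype.ext h)
    obtain ⟨x, hx⟩ := DFunLike.ne_iff.1 hne'
    have hint : 0 < ∫ y, (f : G →ᵇ ℝ) (x * y) * ψ y ∂μ := by
      refine Continuous.integral_pos_of_hasCompactSupport_nonneg_nonzero (μ := μ) (x := 1) (by fun_prop)
        hψs.mul_left (fun y => mul_nonneg (hf _) (hψ0 y)) (mul_ne_zero ?_ hψ1)
      simpa using hx
    exact hint.ne' (DFunLike.congr_fun hf0 x)
  · intro g f
    ext x
    change ∫ y, (f : G →ᵇ ℝ) (g⁻¹ * (x * y)) * ψ y ∂μ = ∫ y, (f : G →ᵇ ℝ) (g⁻¹ * x * y) * ψ y ∂μ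
    simp only [mul_assoc]

end RightConvolution

/-! ### The modular function -/

section ModularCharacter

open MeasureTheory.Measure

variable {G : Type*} [Group G] [TopologicalSpace G] [IsTopologicalGroup G]
  [LocallyCompactSpace G] [MeasurableSpace G] [BorelSpace G] (μ : Measure G) [μ.IsHaarMeasure]

/-- Right translation pushes `μ` to another left-invariant measure. Testing only on compactly
supported continuous functions avoids any regularity assumption on `μ`. -/
theorem integral_comp_mul_right {k : G → ℝ} (hk : Continuous k) (hks : HasCompactSupport k)
    (g : G) : ∫ x, k (x * g) ∂μ = modularCharacterFun g * ∫ x, k x ∂μ := by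
  have h := integral_isMulLeftInvariant_eq_smul_of_hasCompactSupport (map (· * g) μ) μ hk hks
  rw [integral_map (by fun_prop) hk.aestronglyMeasurable, integral_smul_nnreal_measure,
    ← modularCharacterFun_eq_haarScalarFactor μ g] at h
  exact h

theorem continuous_modularCharacterFun :
    Continuous fun g : G => (modularCharacterFun g : ℝ) := by
  let μ : Measure G := haar
  obtain ⟨k, hks, hk0, hk1⟩ := exists_continuous_nonneg_pos (1 : G)
  have hpos : 0 < ∫ x, k x ∂μ :=
    k.continuous.integral_pos_of_hasCompactSupport_nonneg_nonzero hks hk0 hk1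
  have h1 : (fun g : G => (modularCharacterFun g : ℝ)) =
      fun g => (∫ x, k (x * g) ∂μ) / ∫ x, k x ∂μ := by
    ext g
    rw [integral_comp_mul_right μ k.continuous hks, mul_div_cancel_right₀ _ hpos.ne']
  -- Passing to the inverted measure gives the convolution form whose continuity in `g` is known.
  have h2 : (fun g : G => ∫ x, k (x * g) ∂μ) = fun g => ∫ x, k (x⁻¹ * g) ∂μ.inv := by
    ext g
    have hinv : MeasurableEmbedding (Inv.inv : G → G) := (Homeomorph.inv G).measurableEmbedding
    rw [Measure.inv, hinv.integral_map]
    simp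
  rw [h1]
  refine Continuous.div_const ?_ _
  rw [h2]
  exact continuous_integral_apply_inv_mul k.continuous hks

/-- The modular function is a density turning a left Haar measure into a right Haar measure. -/
theorem integral_comp_mul_right_mul_modularCharacterFun {k : G → ℝ} (hk : Continuous k)
    (hks : HasCompactSupport k) (g : G) :
    ∫ x, k (x * g) * modularCharacterFun x ∂μ = ∫ x, k x * modularCharacterFun x ∂μ := by
  have hg : (modularCharacterFun g : ℝ) ≠ 0 := (NNReal.coe_pos.2 (modularCharacterFun_pos g)).ne'
  have h := integral_comp_mul_right μ (k := fun x => k x * modularCharacterFun x) (hk.mul (continuous_modularCharacterFun)) hks.mul_right g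
  simp only [modularCharacterFun_map_mul, NNReal.coe_mul] at h
  refine mul_left_cancel₀ hg (Eq.trans ?_ h)
  rw [← integral_const_mul]
  congr with x
  ring

end ModularCharacter

/-! ### Uniqueness of the Haar functional -/

section HaarFunctional

variable {G : Type*} [Group G] [TopologicalSpace G] [IsTopologicalGroup G]
  [LocallyCompactSpace G] [T2Space G] [MeasurableSpace G] [BorelSpace G]

/-- A positive left-invariant functional on `C_c(G, ℝ)` is a multiple of the Haar integral. -/
theorem exists_eq_mul_integral_of_leftInvariant (μ : Measure G) [μ.IsHaarMeasure]
    (L : C_c(G, ℝ) →ₗ[ℝ] ℝ) (hpos : ∀ φ, 0 ≤ φ → 0 ≤ L φ)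
    (hinv : ∀ g φ, L (leftTranslate g φ) = L φ) : ∃ c : ℝ, ∀ φ, L φ = c * ∫ x, φ x ∂μ := by
  let Λ : C_c(G, ℝ) →ₚ[ℝ] ℝ := PositiveLinearMap.mk₀ L hpos
  let ν := RealRMK.rieszMeasure Λ
  have hν : ∀ φ : C_c(G, ℝ), ∫ x, φ x ∂ν = L φ := RealRMK.integral_rieszMeasure Λ
  have : ν.Regular := inferInstanceAs (RealRMK.rieszMeasure Λ).Regular
  -- Both measures are regular, so integrals of compactly supported functions determine them and
  -- invariance of `L` passes to `ν`.
  have : ν.IsMulLeftInvariant := ⟨fun g => by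
    have : (ν.map (g * ·)).Regular := Measure.Regular.map (Homeomorph.mulLeft g)
    refine Measure.ext_of_integral_eq_on_compactlySupported fun φ => ?_
    rw [integral_map (by fun_prop) (map_continuous φ).aestronglyMeasurable, hν φ,
      ← hinv g⁻¹ φ, ← hν]
    simp [leftTranslate_apply]⟩
  refine ⟨Measure.haarScalarFactor ν μ, fun φ => ?_⟩
  rw [← hν, Measure.integral_isMulLeftInvariant_eq_smul_of_hasCompactSupport ν μ (map_continuous φ)
    φ.hasCompactSupport, integral_smul_nnreal_measure]
  rfl

end HaarFunctional

/-! ### Left convolution of `L^∞` classes -/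

section LeftConvolution

open MeasureTheory.Measure

variable {G : Type*} [Group G] [TopologicalSpace G] [IsTopologicalGroup G]
  [LocallyCompactSpace G] [T2Space G] [MeasurableSpace G] [BorelSpace G]
  (μ : Measure G) [μ.IsHaarMeasure]

/-- The function `w ↦ φ (w⁻¹)`. -/
def reflect (φ : C_c(G, ℝ)) : C_c(G, ℝ) :=
  ⟨⟨fun x => φ x⁻¹, by fun_prop⟩, φ.hasCompactSupport.comp_homeomorph (Homeomorph.inv G)⟩

theorem reflect_apply (φ : C_c(G, ℝ)) (x : G) : reflect φ x = φ x⁻¹ := rfl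

/-- The convolution `x ↦ ∫ φ (x z⁻¹) h z dz` for the right Haar measure with density the modular
function. -/
noncomputable def leftConvolution (φ : C_c(G, ℝ)) (h : G → ℝ) (x : G) : ℝ :=
  ∫ z, φ (x * z⁻¹) * modularCharacterFun z * h z ∂μ

/-- The kernel `z ↦ φ (x z⁻¹) Δ z` of a left convolution. -/
noncomputable def convolutionKernel (φ : C_c(G, ℝ)) (x : G) : C_c(G, ℝ) :=
  ⟨⟨fun z => φ (x * z⁻¹) * modularCharacterFun z,
      (by fun_prop : Continuous fun z => φ (x * z⁻¹)).mul (continuous_modularCharacterFun)⟩,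
    (φ.hasCompactSupport.comp_homeomorph
      ((Homeomorph.inv G).trans (Homeomorph.mulLeft x))).mul_right⟩

theorem convolutionKernel_apply (φ : C_c(G, ℝ)) (x z : G) :
    convolutionKernel φ x z = φ (x * z⁻¹) * modularCharacterFun z := rfl

theorem leftConvolution_eq (φ : C_c(G, ℝ)) (h : G → ℝ) (x : G) :
    leftConvolution μ φ h x = ∫ z, convolutionKernel φ x z * h z ∂μ := rfl

/-- The kernel has compact support, on which locally null means null. This lets left convolution
descend to classes without σ-compactness. -/
theorem convolutionKernel_mul_ae_of_locallyAE (φ : C_c(G, ℝ)) (x : G) {p : G → Prop}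
    (h : ∀ᶠ z in locallyAE μ, p z) : ∀ᵐ z ∂μ, convolutionKernel φ x z = 0 ∨ p z := by
  filter_upwards [ae_imp_of_eventually_locallyAE h (convolutionKernel φ x).hasCompactSupport]
    with z hz
  by_cases hz' : z ∈ tsupport (convolutionKernel φ x)
  · exact Or.inr (hz hz')
  · exact Or.inl (image_eq_zero_of_notMem_tsupport hz')

theorem leftConvolution_congr (φ : C_c(G, ℝ)) {h k : G → ℝ} (hk : h =ᶠ[locallyAE μ] k) :
    leftConvolution μ φ h = leftConvolution μ φ k := by
  ext x
  rw [leftConvolution_eq, leftConvolution_eq]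
  refine integral_congr_ae ?_
  filter_upwards [convolutionKernel_mul_ae_of_locallyAE μ φ x hk] with z hz
  rcases hz with hz | hz <;> simp [hz]

theorem leftConvolution_nonneg {φ : C_c(G, ℝ)} (hφ : 0 ≤ φ) {h : G → ℝ}
    (hh : ∀ᶠ z in locallyAE μ, 0 ≤ h z) (x : G) : 0 ≤ leftConvolution μ φ h x := by
  rw [leftConvolution_eq]
  refine integral_nonneg_of_ae ?_
  filter_upwards [convolutionKernel_mul_ae_of_locallyAE μ φ x hh] with z hz
  rcases hz with hz | hz
  · simp [hz]
  · exact mul_nonneg (mul_nonneg (hφ _) (NNReal.coe_nonneg _)) hz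

theorem integrable_convolutionKernel_mul (φ : C_c(G, ℝ)) (x : G) {h : G → ℝ} (hm : Measurable h)
    {C : ℝ} (hC : ∀ z, |h z| ≤ C) : Integrable (fun z => convolutionKernel φ x z * h z) μ :=
  (convolutionKernel φ x).integrable.mul_bdd hm.aestronglyMeasurable (Eventually.of_forall hC)

/-- The kernel at `x` is a right translate of `reflect φ` times the modular density; right
invariance of the weighted measure makes the bound uniform in `x`. -/
theorem abs_leftConvolution_le (φ : C_c(G, ℝ)) {h : G → ℝ} {C : ℝ} (hC : ∀ z, |h z| ≤ C) (x : G) :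
    |leftConvolution μ φ h x| ≤ C * ∫ z, |reflect φ z| * modularCharacterFun z ∂μ := by
  rw [← integral_comp_mul_right_mul_modularCharacterFun μ (map_continuous (reflect φ)).abs
    ((reflect φ).hasCompactSupport.comp_left abs_zero) x⁻¹, ← integral_const_mul,
    leftConvolution_eq]
  have hk : ∀ z, |reflect φ (z * x⁻¹)| * modularCharacterFun z = |convolutionKernel φ x z| := by
    intro z
    rw [convolutionKernel_apply, abs_mul, abs_of_nonneg (NNReal.coe_nonneg _)]
    simp [reflect_apply]
  simp only [hk]
  rw [← Real.norm_eq_abs]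
  refine norm_integral_le_of_norm_le ((convolutionKernel φ x).integrable.abs.const_mul C)
    (Eventually.of_forall fun z => ?_)
  rw [norm_mul, mul_comm]
  exact mul_le_mul_of_nonneg_right (hC z) (norm_nonneg _)

theorem leftConvolution_add_left (φ ψ : C_c(G, ℝ)) {h : G → ℝ} (hm : Measurable h)
    {C : ℝ} (hC : ∀ z, |h z| ≤ C) (x : G) : leftConvolution μ (φ + ψ) h x =
      leftConvolution μ φ h x + leftConvolution μ ψ h x := by
  simp only [leftConvolution_eq]
  rw [← integral_add (integrable_convolutionKernel_mul μ φ x hm hC)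
    (integrable_convolutionKernel_mul μ ψ x hm hC)]
  congr with z
  simp only [convolutionKernel_apply, CompactlySupportedContinuousMap.add_apply]
  ring

theorem leftConvolution_smul_left (c : ℝ) (φ : C_c(G, ℝ)) (h : G → ℝ) (x : G) :
    leftConvolution μ (c • φ) h x = c * leftConvolution μ φ h x := by
  simp only [leftConvolution_eq]
  rw [← integral_const_mul]
  congr with z
  simp only [convolutionKernel_apply, CompactlySupportedContinuousMap.smul_apply, smul_eq_mul]
  ring

theorem leftConvolution_add_right (φ : C_c(G, ℝ)) {h k : G → ℝ} (hm : Measurable h)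
    (km : Measurable k) {C D : ℝ} (hC : ∀ z, |h z| ≤ C) (hD : ∀ z, |k z| ≤ D) (x : G) :
    leftConvolution μ φ (h + k) x = leftConvolution μ φ h x + leftConvolution μ φ k x := by
  simp only [leftConvolution_eq]
  rw [← integral_add (integrable_convolutionKernel_mul μ φ x hm hC)
    (integrable_convolutionKernel_mul μ φ x km hD)]
  congr with z
  exact mul_add _ _ _

theorem leftConvolution_smul_right (c : ℝ) (φ : C_c(G, ℝ)) (h : G → ℝ) (x : G) :
    leftConvolution μ φ (c • h) x = c * leftConvolution μ φ h x := by
  simp only [leftConvolution_eq]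
  rw [← integral_const_mul]
  congr with z
  exact mul_left_comm _ _ _

theorem leftConvolution_leftTranslate (g : G) (φ : C_c(G, ℝ)) (h : G → ℝ) (x : G) :
    leftConvolution μ (leftTranslate g φ) h x = leftConvolution μ φ h (g⁻¹ * x) := by
  simp only [leftConvolution, leftTranslate_apply, mul_assoc]

/-- Substituting `z ↦ g * z` produces both the right translate of `φ` and the modular factor. This
is the exact defect of equivariance. -/
theorem leftConvolution_comp_mul_left (g : G) (φ : C_c(G, ℝ)) (h : G → ℝ) (x : G) :
    leftConvolution μ φ (fun z => h (g⁻¹ * z)) x =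
      modularCharacterFun g * leftConvolution μ (rightTranslate g φ) h x := by
  rw [leftConvolution, leftConvolution, ← integral_const_mul, ← integral_mul_left_eq_self _ g]
  congr with z
  simp only [rightTranslate_apply, modularCharacterFun_map_mul, mul_inv_rev, inv_mul_cancel_left,
    NNReal.coe_mul, mul_assoc]
  ring

/-- The difference is itself a left convolution, by a translate of `φ` minus `φ`, so the uniform
bound applies to it. -/
theorem leftConvolution_mul_sub (φ : C_c(G, ℝ)) {h : G → ℝ} (hm : Measurable h) {C : ℝ}
    (hC : ∀ z, |h z| ≤ C) (u x : G) :
    |leftConvolution μ φ h (u * x) - leftConvolution μ φ h x| ≤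
      C * ∫ z, |reflect φ (z * u⁻¹) - reflect φ z| * modularCharacterFun z ∂μ := by
  have h1 : leftConvolution μ φ h (u * x) - leftConvolution μ φ h x =
      leftConvolution μ (leftTranslate u⁻¹ φ + (-1 : ℝ) • φ) h x := by
    rw [leftConvolution_add_left μ _ _ hm hC, leftConvolution_smul_left,
      leftConvolution_leftTranslate]
    simp [sub_eq_add_neg]
  rw [h1]
  convert abs_leftConvolution_le μ (leftTranslate u⁻¹ φ + (-1 : ℝ) • φ) hC x using 6 with z
  simp [reflect_apply, leftTranslate_apply, sub_eq_add_neg]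

theorem leftConvolution_uniform (φ : C_c(G, ℝ)) {h : G → ℝ} (hm : Measurable h) {C : ℝ}
    (hC : ∀ z, |h z| ≤ C) (ε : ℝ) (hε : 0 < ε) : ∀ᶠ u in 𝓝 (1 : G), ∀ x,
      |leftConvolution μ φ h (u * x) - leftConvolution μ φ h x| < ε := by
  have h := (tendsto_integral_abs_comp_sub μ (reflect φ).continuous (reflect φ).hasCompactSupport
    (continuous_modularCharacterFun) (a := fun u z => z * u⁻¹) (b := fun u z => z * u)
    (by fun_prop) (by fun_prop) (by simp) (by simp)).const_mul C
  rw [mul_zero] at h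
  filter_upwards [h.eventually_lt_const hε] with u hu x
  exact (leftConvolution_mul_sub μ φ hm hC u x).trans_lt hu

/-- The bounded continuous function obtained by left convolution from a class in `L^∞(G)`. -/
noncomputable def convolutionLinfty (φ : C_c(G, ℝ)) (F : Linfty μ) : G →ᵇ ℝ where
  toFun := (F : Germ (locallyAE μ) ℝ).liftOn (leftConvolution μ φ)
    fun _ _ h => leftConvolution_congr μ φ h
  continuous_toFun := by
    obtain ⟨_, f, hf, ⟨C, hC⟩, rfl⟩ := F
    exact continuous_of_forall_eventually_mul_left (leftConvolution_uniform μ φ hf hC)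
  map_bounded' := by
    obtain ⟨_, f, hf, ⟨C, hC⟩, rfl⟩ := F
    exact Metric.isBounded_range_iff.1 (isBounded_iff_forall_norm_le.2
      ⟨_, Set.forall_mem_range.2 (abs_leftConvolution_le μ φ hC)⟩)

theorem convolutionLinfty_mem_Cru (φ : C_c(G, ℝ)) (F : Linfty μ) :
    convolutionLinfty μ φ F ∈ Cru G := by
  obtain ⟨_, f, hf, ⟨C, hC⟩, rfl⟩ := F
  exact leftConvolution_uniform μ φ hf hC

theorem convolutionLinfty_leftTranslate (g : G) (φ : C_c(G, ℝ)) (F : Linfty μ) :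
    convolutionLinfty μ (leftTranslate g φ) F = translationBCF G g (convolutionLinfty μ φ F) := by
  obtain ⟨_, f, hf, ⟨C, hC⟩, rfl⟩ := F
  ext x
  exact leftConvolution_leftTranslate μ g φ f x

theorem convolutionLinfty_translationGerm (g : G) (φ : C_c(G, ℝ)) (F : Linfty μ) :
    convolutionLinfty μ φ ⟨translationGerm μ g F, translationGerm_mem_Linfty μ g F F.2⟩ =
      (modularCharacterFun g : ℝ) • convolutionLinfty μ (rightTranslate g φ) F := by
  obtain ⟨_, f, hf, ⟨C, hC⟩, rfl⟩ := F
  ext x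
  exact leftConvolution_comp_mul_left μ g φ f x

theorem convolutionLinfty_nonneg {φ : C_c(G, ℝ)} (hφ : 0 ≤ φ) {F : Linfty μ}
    (hF : 0 ≤ (F : Germ (locallyAE μ) ℝ)) : 0 ≤ convolutionLinfty μ φ F := by
  obtain ⟨_, f, hf, ⟨C, hC⟩, rfl⟩ := F
  exact leftConvolution_nonneg μ hφ (Germ.coe_le.1 hF)

/-- Left convolution as a bilinear map. -/
noncomputable def convolutionBilin : C_c(G, ℝ) →ₗ[ℝ] Linfty μ →ₗ[ℝ] (G →ᵇ ℝ) :=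
  LinearMap.mk₂ ℝ (convolutionLinfty μ)
    (fun φ ψ F => by
      obtain ⟨_, f, hf, ⟨C, hC⟩, rfl⟩ := F
      ext x
      exact leftConvolution_add_left μ φ ψ hf hC x)
    (fun c φ F => by
      obtain ⟨_, f, hf, ⟨C, hC⟩, rfl⟩ := F
      ext x
      exact leftConvolution_smul_left μ c φ f x)
    (fun φ F H => by
      obtain ⟨_, f, hf, ⟨C, hC⟩, rfl⟩ := F
      obtain ⟨_, h, hh, ⟨D, hD⟩, rfl⟩ := H
      ext x
      exact leftConvolution_add_right μ φ hf hh hC hD x)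
    (fun c φ F => by
      obtain ⟨_, f, hf, ⟨C, hC⟩, rfl⟩ := F
      ext x
      exact leftConvolution_smul_right μ c φ f x)

theorem convolutionBilin_apply (φ : C_c(G, ℝ)) (F : Linfty μ) :
    convolutionBilin μ φ F = convolutionLinfty μ φ F := rfl

/-- Some left convolution of a given non-zero nonnegative class is non-zero. -/
theorem exists_convolutionLinfty_ne_zero {F : Linfty μ} (h0 : 0 ≤ (F : Germ (locallyAE μ) ℝ))
    (hF : (F : Germ (locallyAE μ) ℝ) ≠ 0) :
    ∃ φ : C_c(G, ℝ), 0 ≤ φ ∧ (∃ a, φ a ≠ 0) ∧ convolutionLinfty μ φ F ≠ 0 := by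
  obtain ⟨_, f, hf, ⟨C, hC⟩, rfl⟩ := F
  obtain ⟨K, hK, hμK⟩ : ∃ K : Set G, IsCompact K ∧ μ ({x | f x = 0}ᶜ ∩ K) ≠ 0 := by
    by_contra! hcon
    exact hF (Germ.coe_eq.2 hcon)
  -- With `φ = 1` on `K⁻¹`, the kernel at `x = 1` is positive on `K`, where `f` is non-zero on a set
  -- of positive measure.
  obtain ⟨φ, hφ1, -, hφs, hφ⟩ := exists_continuous_one_zero_of_isCompact hK.inv isClosed_empty
    (Set.disjoint_empty _)
  let φ' : C_c(G, ℝ) := ⟨φ, hφs⟩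
  obtain ⟨a, ha⟩ : K.Nonempty := by
    rw [Set.nonempty_iff_ne_empty]
    rintro rfl
    simp at hμK
  have hφ0 : 0 ≤ φ' := fun x => (hφ x).1
  refine ⟨φ', hφ0, ⟨a⁻¹, ?_⟩, fun hzero => ?_⟩
  · have : φ' a⁻¹ = 1 := hφ1 (Set.inv_mem_inv.2 ha)
    simp [this]
  · have hpos : 0 < leftConvolution μ φ' f 1 := by
      rw [leftConvolution_eq, integral_pos_iff_support_of_nonneg_ae ?_
        (integrable_convolutionKernel_mul μ φ' 1 hf hC)]
      · refine (pos_iff_ne_zero.2 hμK).trans_le (measure_mono fun z hz => ?_)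
        refine mul_ne_zero ?_ hz.1
        have h1 : φ' z⁻¹ = 1 := hφ1 (Set.inv_mem_inv.2 hz.2)
        rw [convolutionKernel_apply, one_mul, h1, one_mul]
        exact (NNReal.coe_pos.2 (modularCharacterFun_pos z)).ne'
      · filter_upwards [convolutionKernel_mul_ae_of_locallyAE μ φ' 1 (Germ.coe_le.1 h0)] with z hz
        rcases hz with hz | hz
        · simp [hz]
        · exact mul_nonneg (mul_nonneg (hφ0 _) (NNReal.coe_nonneg _)) hz
    exact hpos.ne' (DFunLike.congr_fun hzero 1)

end LeftConvolution

/-! ### From `Cru` to `L^∞` by uniqueness of Haar measure -/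

section LinftyOfCru

open MeasureTheory.Measure

variable {G : Type*} [Group G] [TopologicalSpace G] [IsTopologicalGroup G]
  [LocallyCompactSpace G] [T2Space G] [MeasurableSpace G] [BorelSpace G]
  (μ : Measure G) [μ.IsHaarMeasure]

/-- For `ψ ≥ 0` and `H = F`, dominate `ψ` by left translates of `φ`, which convolve to translates of
`φ * F`. A translate of `F` only changes `ψ` to a multiple of its right translate, so positivity
extends this to `H`. A general `ψ` is split into positive and negative parts. -/
theorem convolutionBilin_mem_dominatedIdeal {φ : C_c(G, ℝ)} (hφ : 0 ≤ φ) {a : G} (ha : φ a ≠ 0)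
    {F : Linfty μ} (hF : 0 ≤ (F : Germ (locallyAE μ) ℝ)) (ψ : C_c(G, ℝ)) {H : Linfty μ}
    (hH : (H : Germ (locallyAE μ) ℝ) ∈ dominatedIdeal (translationGerm μ) (Linfty μ) F) :
    convolutionBilin μ ψ H ∈
      dominatedIdeal (translationBCF G) (Cru G) (convolutionBilin μ φ F) := by
  have hF' : ∀ ψ : C_c(G, ℝ), 0 ≤ ψ → convolutionBilin μ ψ F ∈
      dominatedIdeal (translationBCF G) (Cru G) (convolutionBilin μ φ F) := by
    intro ψ hψ
    obtain ⟨t, ht, hle⟩ := exists_le_sum_leftTranslate hφ ha ψ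
    refine ⟨convolutionLinfty_mem_Cru μ ψ F, t, ht, ?_⟩
    rw [convolutionBilin_apply μ ψ, abs_of_nonneg (convolutionLinfty_nonneg μ hψ hF)]
    have h1 : 0 ≤ convolutionBilin μ (t.sum (fun g c => c • leftTranslate g φ) - ψ) F :=
      convolutionLinfty_nonneg μ (sub_nonneg.2 hle) hF
    rw [map_sub, LinearMap.sub_apply, sub_nonneg] at h1
    refine h1.trans_eq ?_
    rw [Finsupp.sum, _root_.map_sum, LinearMap.sum_apply]
    refine Finset.sum_congr rfl fun g _ => ?_
    rw [map_smul, LinearMap.smul_apply, convolutionBilin_apply, convolutionLinfty_leftTranslate,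
      convolutionBilin_apply]
  have hpos : ∀ ψ : C_c(G, ℝ), 0 ≤ ψ → convolutionBilin μ ψ H ∈
      dominatedIdeal (translationBCF G) (Cru G) (convolutionBilin μ φ F) := by
    intro ψ hψ
    refine map_mem_dominatedIdeal (fun K hK => convolutionLinfty_nonneg μ hψ hK)
      (fun g => translationGerm_mem_Linfty μ g F F.2) (fun g => ?_) hH
      (convolutionLinfty_mem_Cru μ ψ H)
    rw [convolutionBilin_apply μ ψ, convolutionLinfty_translationGerm]
    exact Submodule.smul_mem _ _ (hF' _ fun x => hψ (x * g⁻¹))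
  rw [← posPart_sub_negPart ψ, map_sub, LinearMap.sub_apply]
  exact Submodule.sub_mem _ (hpos _ (posPart_nonneg ψ)) (hpos _ (negPart_nonneg ψ))

theorem integral_rightTranslate (g : G) (φ : C_c(G, ℝ)) :
    modularCharacterFun g * ∫ x, rightTranslate g φ x ∂μ = ∫ x, φ x ∂μ := by
  rw [← integral_comp_mul_right μ (map_continuous _) (rightTranslate g φ).hasCompactSupport]
  simp [rightTranslate_apply]

theorem Linfty_of_Cru (h : InvariantNormalizedIntegralProperty (translationBCF G) (Cru G)) :
    InvariantNormalizedIntegralProperty (translationGerm μ) (Linfty μ) := by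
  intro F hF h0 hne
  obtain ⟨φ, hφ, ⟨a, ha⟩, hφF⟩ :=
    exists_convolutionLinfty_ne_zero μ (F := ⟨F, hF⟩) h0 hne
  obtain ⟨I, Ipos, Iinv, Inorm⟩ := h (convolutionBilin μ φ ⟨F, hF⟩)
    (convolutionLinfty_mem_Cru μ φ _) (convolutionLinfty_nonneg μ hφ h0) hφF
  have hmem : ∀ (ψ : C_c(G, ℝ)) (H : Linfty μ),
      (H : Germ (locallyAE μ) ℝ) ∈ dominatedIdeal (translationGerm μ) (Linfty μ) F →
      convolutionBilin μ ψ H ∈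
        dominatedIdeal (translationBCF G) (Cru G) (convolutionBilin μ φ ⟨F, hF⟩) :=
    fun ψ H hH => convolutionBilin_mem_dominatedIdeal μ hφ ha (F := ⟨F, hF⟩) h0 ψ hH
  let J : C_c(G, ℝ) → dominatedIdeal (translationGerm μ) (Linfty μ) F →ₗ[ℝ] ℝ := fun ψ =>
    I ∘ₗ dominatedIdealMap (translationGerm μ) (translationBCF G) (Cru G) F _
      (convolutionBilin μ ψ) (hmem ψ)
  have hJpos : ∀ ψ, 0 ≤ ψ → ∀ H : dominatedIdeal (translationGerm μ) (Linfty μ) F,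
      0 ≤ (H : Germ (locallyAE μ) ℝ) → 0 ≤ J ψ H := fun ψ hψ H hH =>
    Ipos _ (convolutionLinfty_nonneg μ hψ (F := ⟨H, H.2.1⟩) hH)
  have hinv_nonneg : ∀ (g : G) (H H' : dominatedIdeal (translationGerm μ) (Linfty μ) F),
      0 ≤ (H : Germ (locallyAE μ) ℝ) → (H' : Germ (locallyAE μ) ℝ) = translationGerm μ g H →
      J φ H' = J φ H := by
    -- `H ≥ 0` is what makes `ψ ↦ J ψ H` positive, hence a multiple of the Haar integral.
    intro g H H' hH hHH'
    let L : C_c(G, ℝ) →ₗ[ℝ] ℝ :=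
      { toFun := fun ψ => J ψ H
        map_add' := fun ψ χ => by
          change I _ = I _ + I _
          rw [← map_add]
          congr 1
          exact Subtype.ext (LinearMap.map_add₂ (convolutionBilin μ) ψ χ _)
        map_smul' := fun c ψ => by
          change I _ = c • I _
          rw [← map_smul]
          congr 1
          exact Subtype.ext (LinearMap.map_smul₂ (convolutionBilin μ) c ψ _) }
    obtain ⟨c, hc⟩ := exists_eq_mul_integral_of_leftInvariant μ L (fun ψ hψ => hJpos ψ hψ H hH)
      fun k ψ => Iinv k _ _ (convolutionLinfty_leftTranslate μ k ψ ⟨H, H.2.1⟩)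
    have h1 : J φ H' = modularCharacterFun g * L (rightTranslate g φ) := by
      change I _ = (modularCharacterFun g : ℝ) • I _
      rw [← map_smul]
      congr 1
      refine Subtype.ext (Eq.trans ?_ (convolutionLinfty_translationGerm μ g φ ⟨H, H.2.1⟩))
      exact congrArg (convolutionLinfty μ φ) (Subtype.ext hHH')
    -- The modular factor cancels the change of the Haar integral under right translation.
    rw [h1, hc, mul_left_comm, integral_rightTranslate, ← hc]
    rfl
  have hnn : ∀ g, 0 ≤ translationGerm μ g F := fun g => translationGerm_nonneg μ g F h0
  have hL : ∀ g, translationGerm μ g F ∈ Linfty μ := fun g => translationGerm_mem_Linfty μ g F hF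
  refine ⟨J φ, hJpos φ hφ, fun g H H' hHH' => ?_, Inorm⟩
  -- Both `S` and `H + S` are nonnegative, so invariance at `H` follows by subtraction.
  obtain ⟨S, hS, hHS⟩ := exists_abs_le_mem_dominatedIdeal hL hnn H.2
  have hS0 : 0 ≤ S := (abs_nonneg _).trans hHS
  have hHS0 : 0 ≤ (H : Germ (locallyAE μ) ℝ) + S := by
    rw [← neg_le_iff_add_nonneg']
    exact (neg_le_abs _).trans hHS
  let S₁ : dominatedIdeal (translationGerm μ) (Linfty μ) F := ⟨S, hS⟩
  let S₂ : dominatedIdeal (translationGerm μ) (Linfty μ) F :=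
    ⟨translationGerm μ g S, map_translate_mem_dominatedIdeal (translationGerm_nonneg μ)
      (translationGerm_mem_Linfty μ) h0 hF g hS⟩
  have h1 := hinv_nonneg g S₁ S₂ hS0 rfl
  have h2 := hinv_nonneg g (H + S₁) (H' + S₂) hHS0 (by
    rw [Submodule.coe_add, Submodule.coe_add, map_add, hHH'])
  rw [map_add, map_add, h1] at h2
  exact add_right_cancel h2

end LinftyOfCru

theorem mainTheorem1 {G : Type*} [Group G] [TopologicalSpace G] [IsTopologicalGroup G]
    [LocallyCompactSpace G] [T2Space G] [MeasurableSpace G] [BorelSpace G]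
    (μ : Measure G) [μ.IsHaarMeasure] :
    List.TFAE [
      InvariantNormalizedIntegralProperty (translationGerm μ) (Linfty μ),
      InvariantNormalizedIntegralProperty (translationBCF G) (Cb G),
      InvariantNormalizedIntegralProperty (translationBCF G) (Clu G),
      InvariantNormalizedIntegralProperty (translationBCF G) (Cru G),
      InvariantNormalizedIntegralProperty (translationBCF G) (Cu G)] := by
  tfae_have 1 → 2 := Cb_of_Linfty μ
  tfae_have 2 → 3 := fun h => h.mono (fun _ _ => trivial) translationBCF_nonneg
    translationBCF_mem_Clu
  tfae_have 2 → 4 := fun h => h.mono (fun _ _ => trivial) translationBCF_nonneg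
    translationBCF_mem_Cru
  tfae_have 3 → 5 := fun h => h.mono inf_le_left translationBCF_nonneg translationBCF_mem_Cu
  tfae_have 4 → 1 := Linfty_of_Cru μ
  tfae_have 5 → 4 := Cru_of_Cu
  tfae_finish
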